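/- Let $X$ be a compact Hausdorff space, $U\subseteq X$ an open subset and $\sigma:U\to X$ a local homeomorphism, and let $\alpha(f)=f\circ\sigma$ for $f\in C(X)$. For a continuous function $\rho:U\to[0,\infty)$ let $L_\rho:C_c(U)\to C(X)$ be the transfer operator $$L_\rho(f)(x)=\sum_{y\in\sigma^{-1}(x)}\rho(y)f(y)\quad(x\in\sigma(U)),\qquad L_\rho(f)(x)=0\quad(x\notin\sigma(U)).$$ Let $M_\rho$ be the Hilbert bimodule over $C(X)$ obtained from $C_c(U)$ by separation and completion for the norm $\|g\|=\|L_\rho(g^*g)\|^{1/2}$; write $\hat g$ for the class of $g$. Its operations are determined by $\langle\hat g,\hat h\rangle=L_\rho(g^*h)$, $\hat g\,f=(g\,\alpha(f))^{\wedge}$ and $\varphi_\rho(f)\hat g=f\hat g=(f|_U\,g)^{\wedge}$. Let $K(M_\rho)$ be the closed linear span of the operators $x\mapsto m\langle n,x\rangle$, $m,n\in M_\rho$. Let $\mathcal T(X,\alpha,L_\rho)$ be the universal $C^*$-algebra generated by $C(X)\cup M_\rho$ with the relations of $C(X)$, the relations of $M_\rho$, the bimodule products, and $m^*n=\langle m,n\rangle$.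 Let $\widehat K_1=\overline{\mathrm{span}}\{mn^*: m,n\in M_\rho\}\subseteq\mathcal T(X,\alpha,L_\rho)$; a redundancy is a pair $(a,k)\in C(X)\times\widehat K_1$ with $am=km$ for all $m\in M_\rho$. The crossed product by a partial endomorphism $\mathcal O(X,\alpha,L_\rho)$ is the quotient of $\mathcal T(X,\alpha,L_\rho)$ by the closed two-sided ideal generated by all elements $a-k$, where $(a,k)$ is a redundancy and $a\in\ker(\varphi_\rho)^{\perp}\cap\varphi_\rho^{-1}(K(M_\rho))$; here $\ker(\varphi_\rho)^\perp=\{a\in C(X): ab=0\text{ for all }b\in\ker\varphi_\rho\}$. **Proposition.** Let $\rho,\rho':U\to[0,\infty)$ be continuous, and suppose that there is a continuous function $r:U\to\mathbb C$ with $r(x)\neq0$ for every $x\in U$ and $\rho=r\rho'$. Then $\mathcal O(X,\alpha,L_\rho)$ and $\mathcal O(X,\alpha,L_{\rho'})$ are $*$-isomorphic. More precisely, there is a $*$-isomorphism $\psi:\mathcal O(X,\alpha,L_\rho)\to\mathcal O(X,\alpha,L_{\rho'})$ with $\psi(f)=f$ for all $f\in C(X)$ and $\psi(\hat g)=(\sqrt{|r|}\,g)^{\wedge}$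 for all $g\in C_c(U)$. (At every point where $\rho'\neq0$ one has $r>0$, so there $\sqrt{|r|}=\sqrt r$; in particular $\sqrt{|r|}=\sqrt r$ everywhere if $r$ is positive.) -/

import Mathlib

open scoped NNReal ENNReal CompactlySupported

noncomputable section

namespace PartialCrossedProduct

section FiberSum

variable {X Y : Type*} {σ : Y → X}

/-- `fiberSum σ f x = ∑_{y ∈ σ⁻¹(x)} f y`; in particular it is `0` for `x ∉ σ(Y)`. -/
def fiberSum (σ : Y → X) (f : Y → ℂ) (x : X) : ℂ := ∑ᶠ y ∈ σ ⁻¹' {x}, f y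

theorem fiberSum_const_mul (c : ℂ) (f : Y → ℂ) (x : X) :
    fiberSum σ (fun y => c * f y) x = c * fiberSum σ f x :=
  (mul_finsum_mem f c).symm

theorem fiberSum_zero (x : X) : fiberSum σ (0 : Y → ℂ) x = 0 := by
  simp [fiberSum]

variable [TopologicalSpace X] [TopologicalSpace Y]

/-- The fibres of a local homeomorphism meet the support of a compactly supported function in
finite sets, so that all the sums in `fiberSum` are finite. -/
theorem finite_fiber_inter_support [T1Space X] (hσ : IsLocalHomeomorph σ) {f : Y → ℂ}
    (hf : HasCompactSupport f) (x : X) : (σ ⁻¹' {x} ∩ Function.support f).Finite := by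
  choose e he1 he2 using hσ
  obtain ⟨t, _, ht⟩ := hf.elim_nhds_subcover (fun y => (e y).source)
    (fun y _ => (e y).open_source.mem_nhds (he1 y))
  refine (t.finite_toSet.biUnion (t := fun i => (e i).source ∩ σ ⁻¹' {x}) ?_).subset ?_
  · intro i _
    refine Set.Subsingleton.finite ?_
    rintro a ⟨ha, ha'⟩ b ⟨hb, hb'⟩
    apply (e i).injOn ha hb
    rw [← he2 i]
    exact (ha' : σ a = x).trans (hb' : σ b = x).symm
  · rintro y ⟨hy, hy'⟩
    obtain ⟨i, hi, hyi⟩ := Set.mem_iUnion₂.1 (ht (subset_tsupport f hy'))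
    exact Set.mem_iUnion₂.2 ⟨i, hi, hyi, hy⟩

theorem fiberSum_add [T1Space X] (hσ : IsLocalHomeomorph σ) {f g : Y → ℂ}
    (hf : HasCompactSupport f) (hg : HasCompactSupport g) (x : X) :
    fiberSum σ (f + g) x = fiberSum σ f x + fiberSum σ g x :=
  finsum_mem_add_distrib' (finite_fiber_inter_support hσ hf x) (finite_fiber_inter_support hσ hg x)

theorem fiberSum_sum [T1Space X] (hσ : IsLocalHomeomorph σ) {ι : Type*} (s : Finset ι)
    (f : ι → Y → ℂ) (hf : ∀ i, HasCompactSupport (f i)) (x : X) :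
    fiberSum σ (∑ i ∈ s, f i) x = ∑ i ∈ s, fiberSum σ (f i) x := by
  classical
  have key : HasCompactSupport (∑ i ∈ s, f i) ∧
      fiberSum σ (∑ i ∈ s, f i) x = ∑ i ∈ s, fiberSum σ (f i) x := by
    induction s using Finset.induction_on with
    | empty => exact ⟨by simpa using HasCompactSupport.zero, by simp [fiberSum_zero]⟩
    | insert a s ha ih =>
      rw [Finset.sum_insert ha, Finset.sum_insert ha, ← ih.2]
      exact ⟨(hf a).add ih.1, fiberSum_add hσ (hf a) ih.1 x⟩
  exact key.2

/-- Continuity of the fibre sum of a function supported in the domain of a local section. -/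
theorem continuous_fiberSum_of_subset [T2Space X] (e : OpenPartialHomeomorph Y X) {f : Y → ℂ}
    (hf : Continuous f) (hc : HasCompactSupport f) (hs : tsupport f ⊆ e.source) :
    Continuous (fiberSum e f) := by
  have h0 : ∀ x, x ∉ e '' tsupport f → fiberSum e f x = 0 := by
    intro x hx
    refine finsum_mem_eq_zero_of_forall_eq_zero fun y hy => ?_
    by_contra hne
    exact hx ⟨y, subset_tsupport f hne, hy⟩
  have h1 : ∀ x ∈ e.target, fiberSum e f x = f (e.symm x) := by
    intro x hx
    have : ∀ y, y ∈ ((e : Y → X) ⁻¹' {x}) ∩ Function.support f ↔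
        y ∈ ({e.symm x} : Set Y) ∩ Function.support f := by
      intro y
      constructor
      · rintro ⟨hy, hy'⟩
        have hy1 : e y = x := hy
        refine ⟨?_, hy'⟩
        rw [← hy1, e.left_inv (hs (subset_tsupport f hy'))]
        rfl
      · rintro ⟨rfl, hy'⟩
        exact ⟨e.right_inv hx, hy'⟩
    have h2 : ((e : Y → X) ⁻¹' {x}) ∩ Function.support f =
        ({e.symm x} : Set Y) ∩ Function.support f := Set.ext this
    rw [fiberSum, finsum_mem_inter_support_eq f _ _ h2, finsum_mem_singleton]
  have hK : IsClosed (e '' tsupport f) := by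
    have : IsCompact (tsupport f) := hc
    exact (this.image_of_continuousOn (e.continuousOn.mono hs)).isClosed
  rw [continuous_iff_continuousAt]
  intro x
  by_cases hx : x ∈ e.target
  · have hxt : e.target ∈ nhds x := e.open_target.mem_nhds hx
    have h3 : ContinuousAt (fun z => f (e.symm z)) x :=
      hf.continuousAt.comp (e.continuousAt_symm hx)
    exact h3.congr (Filter.eventually_of_mem hxt fun z hz => (h1 z hz).symm)
  · have hx' : x ∉ e '' tsupport f := by
      rintro ⟨y, hy, rfl⟩
      exact hx (e.map_source (hs hy))
    have h3 : ContinuousAt (fun _ : X => (0 : ℂ)) x := continuousAt_const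
    exact h3.congr (Filter.eventually_of_mem (hK.isOpen_compl.mem_nhds hx')
      fun z hz => (h0 z hz).symm)

/-- The fibre sums of a continuous function with compact support form a continuous function. -/
theorem continuous_fiberSum [T2Space X] [T2Space Y] [LocallyCompactSpace Y]
    (hσ : IsLocalHomeomorph σ) {f : Y → ℂ} (hf : Continuous f) (hc : HasCompactSupport f) :
    Continuous (fiberSum σ f) := by
  have hσ' := hσ
  choose e he1 he2 using hσ
  obtain ⟨t, _, ht⟩ := hc.elim_nhds_subcover (fun y => (e y).source)
    (fun y _ => (e y).open_source.mem_nhds (he1 y))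
  let q := t.equivFin.symm
  obtain ⟨p, hp1, hp2, -, hp4⟩ := exists_continuous_sum_one_of_isOpen_isCompact
    (s := fun i : Fin t.card => (e (q i)).source) (t := tsupport f)
    (fun i => (e (q i)).open_source) hc (by
      intro y hy
      obtain ⟨i, hi, hyi⟩ := Set.mem_iUnion₂.1 (ht hy)
      refine Set.mem_iUnion.2 ⟨t.equivFin ⟨i, hi⟩, ?_⟩
      simpa [q] using hyi)
  let g : Fin t.card → Y → ℂ := fun i y => (p i y : ℂ) * f y
  have hgc : ∀ i, HasCompactSupport (g i) := fun i => hc.mul_left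
  have hgs : ∀ i, tsupport (g i) ⊆ (e (q i)).source := by
    intro i
    refine Set.Subset.trans (closure_mono ?_) (hp1 i)
    intro y hy
    simp only [g, Function.mem_support, ne_eq, mul_eq_zero, not_or, Complex.ofReal_eq_zero] at hy
    exact hy.1
  have hsum : f = ∑ i, g i := by
    funext y
    simp only [g, Finset.sum_apply, ← Finset.sum_mul, ← Complex.ofReal_sum]
    by_cases hy : y ∈ tsupport f
    · have := hp2 hy
      simp only [Finset.sum_apply, Pi.one_apply] at this
      rw [this]; simp
    · rw [image_eq_zero_of_notMem_tsupport hy, mul_zero]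
  have h : fiberSum σ f = fun x => ∑ i, fiberSum σ (g i) x := by
    funext x
    conv_lhs => rw [hsum]
    exact fiberSum_sum hσ' _ g hgc x
  rw [h]
  refine continuous_finsetSum _ fun i _ => ?_
  have := continuous_fiberSum_of_subset (e (q i)) (f := g i)
    ((Complex.continuous_ofReal.comp (p i).continuous).mul hf) (hgc i) (hgs i)
  rwa [← he2 (q i)] at this

end FiberSum

section System

variable {X : Type*} [TopologicalSpace X] [CompactSpace X] [T2Space X]
  {U : TopologicalSpace.Opens X} {σ : U → X}

/-- The transfer operator `L_ρ : C_c(U) → C(X)`, `L_ρ(f)(x) = ∑_{y ∈ σ⁻¹(x)} ρ(y) f(y)`, of a local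
homeomorphism `σ : U → X` and a positive function `ρ ∈ C(U)`. -/
def transfer (hσ : IsLocalHomeomorph σ) (ρ : C(U, ℝ≥0)) : C_c(U, ℂ) →ₗ[ℂ] C(X, ℂ) where
  toFun f :=
    { toFun := fiberSum σ fun y => ((ρ y : ℝ) : ℂ) * f y
      continuous_toFun := by
        have : LocallyCompactSpace U := U.isOpen.locallyCompactSpace
        exact continuous_fiberSum hσ (by fun_prop) f.hasCompactSupport.mul_left }
  map_add' f g := by
    ext x
    have h := fiberSum_add hσ (f := fun y => ((ρ y : ℝ) : ℂ) * f y)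
      (g := fun y => ((ρ y : ℝ) : ℂ) * g y) f.hasCompactSupport.mul_left
      g.hasCompactSupport.mul_left x
    simp only [ContinuousMap.coe_mk, ContinuousMap.add_apply]
    rw [← h]
    congr 1
    funext y
    simp [mul_add]
  map_smul' c f := by
    ext x
    simp only [ContinuousMap.coe_mk, ContinuousMap.smul_apply, RingHom.id_apply, smul_eq_mul]
    rw [← fiberSum_const_mul]
    congr 1
    funext y
    simp only [CompactlySupportedContinuousMap.smul_apply, smul_eq_mul]
    ring

theorem transfer_apply (hσ : IsLocalHomeomorph σ) (ρ : C(U, ℝ≥0)) (f : C_c(U, ℂ)) (x : X) :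
    transfer hσ ρ f x = ∑ᶠ y ∈ σ ⁻¹' {x}, ((ρ y : ℝ) : ℂ) * f y := rfl

/-- `α : C(X) → C(U)`, `α(f) = f ∘ σ`. -/
def alpha (hσ : IsLocalHomeomorph σ) (f : C(X, ℂ)) : C(U, ℂ) := f.comp ⟨σ, hσ.continuous⟩

/-- The restriction `C(X) → C(U)`, `f ↦ f|_U`, through which `C(X)` acts on `C_c(U)`. -/
def resU (U : TopologicalSpace.Opens X) (f : C(X, ℂ)) : C(U, ℂ) :=
  f.comp ⟨Subtype.val, continuous_subtype_val⟩

theorem transfer_star (hσ : IsLocalHomeomorph σ) (ρ : C(U, ℝ≥0)) (f : C_c(U, ℂ)) :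
    transfer hσ ρ (star f) = star (transfer hσ ρ f) := by
  ext x
  rw [ContinuousMap.star_apply, transfer_apply, transfer_apply]
  have h := (starRingEnd ℂ).toAddMonoidHom.map_finsum_mem' (s := σ ⁻¹' {x})
    (f := fun y => ((ρ y : ℝ) : ℂ) * f y)
    (finite_fiber_inter_support hσ f.hasCompactSupport.mul_left x)
  refine Eq.trans ?_ h.symm
  refine finsum_mem_congr rfl fun y _ => ?_
  simp

theorem transfer_nonneg (hσ : IsLocalHomeomorph σ) (ρ : C(U, ℝ≥0)) (f : C_c(U, ℂ)) (x : X)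
    (hf : ∀ y, 0 ≤ (f y).re) : 0 ≤ (transfer hσ ρ f x).re := by
  rw [transfer_apply]
  refine finsum_mem_induction (p := fun z : ℂ => 0 ≤ z.re) le_rfl ?_ ?_
  · intro a b ha hb
    simpa using add_nonneg ha hb
  · intro y _
    rw [Complex.re_ofReal_mul]
    exact mul_nonneg (ρ y).2 (hf y)

theorem transfer_mul_alpha (hσ : IsLocalHomeomorph σ) (ρ : C(U, ℝ≥0)) (f : C_c(U, ℂ))
    (b : C(X, ℂ)) : transfer hσ ρ (alpha hσ b • f) = transfer hσ ρ f * b := by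
  ext x
  rw [ContinuousMap.mul_apply, transfer_apply, transfer_apply, finsum_mem_mul]
  refine finsum_mem_congr rfl fun y hy => ?_
  have hy' : σ y = x := hy
  simp only [alpha, CompactlySupportedContinuousMap.smulc_apply, ContinuousMap.comp_apply,
    ContinuousMap.coe_mk, hy', smul_eq_mul]
  ring

/-- The positive semidefinite form `(g, h) ↦ L_ρ(g^* h)(x)`. -/
@[reducible] def formCore (hσ : IsLocalHomeomorph σ) (ρ : C(U, ℝ≥0)) (x : X) :
    PreInnerProductSpace.Core ℂ C_c(U, ℂ) where
  inner g h := transfer hσ ρ (star g * h) x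
  conj_inner_symm g h := by
    have : star g * h = star (star h * g) := by simp [mul_comm]
    rw [this, transfer_star]
    rfl
  re_inner_nonneg g := transfer_nonneg hσ ρ _ x fun y => by
    simp [← Complex.normSq_eq_conj_mul_self, Complex.normSq_nonneg]
  add_left f g h := by simp [add_mul]
  smul_left g h c := by simp [smul_mul_assoc]

/-- The space `C_c(U)`, equipped with the seminorm `‖g‖ = ‖L_ρ(g^* g)‖^{1/2}`. -/
def PreM (_hσ : IsLocalHomeomorph σ) (_ρ : C(U, ℝ≥0)) : Type _ := C_c(U, ℂ)

variable (hσ : IsLocalHomeomorph σ) (ρ : C(U, ℝ≥0))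

instance : AddCommGroup (PreM hσ ρ) := inferInstanceAs (AddCommGroup C_c(U, ℂ))

instance : Module ℂ (PreM hσ ρ) := inferInstanceAs (Module ℂ C_c(U, ℂ))

/-- The tautological identification of `C_c(U)` with `PreM hσ ρ`. -/
def toPreM : C_c(U, ℂ) ≃ₗ[ℂ] PreM hσ ρ := LinearEquiv.refl ℂ C_c(U, ℂ)

/-- The `C(X)`-valued semi-inner product `(g, h) = L_ρ(g^* h)` on `C_c(U)`. -/
def preInner : PreM hσ ρ →ₗ⋆[ℂ] PreM hσ ρ →ₗ[ℂ] C(X, ℂ) :=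
  LinearMap.mk₂'ₛₗ (starRingEnd ℂ) (RingHom.id ℂ)
    (fun g h => transfer hσ ρ (star ((toPreM hσ ρ).symm g) * (toPreM hσ ρ).symm h))
    (by intro g g' h; simp [add_mul]) (by intro c g h; simp [smul_mul_assoc])
    (by intro g h h'; simp [mul_add]) (by intro c g h; simp [mul_smul_comm])

theorem re_preInner_le (g : PreM hσ ρ) (x : X) :
    (preInner hσ ρ g g x).re ≤ ‖preInner hσ ρ g g‖ :=
  (Complex.re_le_norm _).trans (ContinuousMap.norm_coe_le_norm _ x)

theorem re_preInner_nonneg (g : PreM hσ ρ) (x : X) : 0 ≤ (preInner hσ ρ g g x).re :=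
  (formCore hσ ρ x).re_inner_nonneg g

theorem norm_preInner_apply_le (g h : PreM hσ ρ) (x : X) :
    ‖preInner hσ ρ g h x‖ ≤ √(preInner hσ ρ g g x).re * √(preInner hσ ρ h h x).re :=
  let := formCore hσ ρ x
  InnerProductSpace.Core.norm_inner_le_norm (𝕜 := ℂ) (F := C_c(U, ℂ)) g h

theorem norm_preInner_self_le {g : PreM hσ ρ} {C : ℝ} (hC : 0 ≤ C)
    (h : ∀ x, √(preInner hσ ρ g g x).re ≤ C) : √‖preInner hσ ρ g g‖ ≤ C := by
  rw [Real.sqrt_le_left hC, ContinuousMap.norm_le _ (by positivity)]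
  intro x
  refine (norm_preInner_apply_le hσ ρ g g x).trans ?_
  rw [pow_two]
  exact mul_le_mul (h x) (h x) (Real.sqrt_nonneg _) hC

instance : SeminormedAddCommGroup (PreM hσ ρ) :=
  AddGroupSeminorm.toSeminormedAddCommGroup
    { toFun := fun g => √‖preInner hσ ρ g g‖
      map_zero' := by simp
      neg' := fun g => by simp
      add_le' := fun g h => by
        refine norm_preInner_self_le hσ ρ (by positivity) fun x => ?_
        have h1 : √(preInner hσ ρ (g + h) (g + h) x).re ≤
            √(preInner hσ ρ g g x).re + √(preInner hσ ρ h h x).re := by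
          let := formCore hσ ρ x
          let := InnerProductSpace.Core.toSeminormedAddCommGroup (𝕜 := ℂ) (F := C_c(U, ℂ))
          exact norm_add_le (E := C_c(U, ℂ)) g h
        exact h1.trans (add_le_add (Real.sqrt_le_sqrt (re_preInner_le hσ ρ g x))
          (Real.sqrt_le_sqrt (re_preInner_le hσ ρ h x))) }

theorem norm_preM (g : PreM hσ ρ) : ‖g‖ = √‖preInner hσ ρ g g‖ := rfl

instance : NormedSpace ℂ (PreM hσ ρ) where
  norm_smul_le c g := by
    have h : preInner hσ ρ (c • g) (c • g) = (starRingEnd ℂ c * c) • preInner hσ ρ g g := by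
      simp [smul_smul, mul_comm]
    rw [norm_preM, norm_preM, h, norm_smul, norm_mul, RCLike.norm_conj,
      Real.sqrt_mul (by positivity), Real.sqrt_mul_self (norm_nonneg c)]

theorem norm_preInner_le (g h : PreM hσ ρ) : ‖preInner hσ ρ g h‖ ≤ 1 * ‖g‖ * ‖h‖ := by
  rw [ContinuousMap.norm_le _ (by positivity)]
  intro x
  refine (norm_preInner_apply_le hσ ρ g h x).trans ?_
  rw [one_mul]
  exact mul_le_mul (Real.sqrt_le_sqrt (re_preInner_le hσ ρ g x))
    (Real.sqrt_le_sqrt (re_preInner_le hσ ρ h x)) (Real.sqrt_nonneg _) (norm_nonneg _)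

/-- The left action `(g, f) ↦ f g` of `C(X)` on `C_c(U)`. -/
def preLeft : PreM hσ ρ →ₗ[ℂ] C(X, ℂ) →ₗ[ℂ] PreM hσ ρ :=
  LinearMap.mk₂ ℂ (fun g f => toPreM hσ ρ (resU U f • (toPreM hσ ρ).symm g))
    (by intro g h f; refine CompactlySupportedContinuousMap.ext fun y => ?_; exact mul_add (_ : ℂ) _ _)
    (by
      intro c g f
      refine CompactlySupportedContinuousMap.ext fun y => ?_
      exact mul_left_comm (_ : ℂ) _ _)
    (by intro g f h; refine CompactlySupportedContinuousMap.ext fun y => ?_; exact add_mul (_ : ℂ) _ _)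
    (by intro c g f; refine CompactlySupportedContinuousMap.ext fun y => ?_; exact mul_assoc (_ : ℂ) _ _)

/-- The right action `(g, f) ↦ g α(f)` of `C(X)` on `C_c(U)`. -/
def preRight : PreM hσ ρ →ₗ[ℂ] C(X, ℂ) →ₗ[ℂ] PreM hσ ρ :=
  LinearMap.mk₂ ℂ (fun g f => toPreM hσ ρ (alpha hσ f • (toPreM hσ ρ).symm g))
    (by intro g h f; refine CompactlySupportedContinuousMap.ext fun y => ?_; exact mul_add (_ : ℂ) _ _)
    (by
      intro c g f
      refine CompactlySupportedContinuousMap.ext fun y => ?_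
      exact mul_left_comm (_ : ℂ) _ _)
    (by intro g f h; refine CompactlySupportedContinuousMap.ext fun y => ?_; exact add_mul (_ : ℂ) _ _)
    (by intro c g f; refine CompactlySupportedContinuousMap.ext fun y => ?_; exact mul_assoc (_ : ℂ) _ _)

theorem norm_preLeft_le (g : PreM hσ ρ) (f : C(X, ℂ)) :
    ‖preLeft hσ ρ g f‖ ≤ 1 * ‖g‖ * ‖f‖ := by
  refine norm_preInner_self_le hσ ρ (by positivity) fun x => ?_
  have key : (preInner hσ ρ (preLeft hσ ρ g f) (preLeft hσ ρ g f) x).re ≤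
      ‖f‖ ^ 2 * (preInner hσ ρ g g x).re := by
    let g' : C_c(U, ℂ) := (toPreM hσ ρ).symm g
    let d : C_c(U, ℂ) := ((‖f‖ ^ 2 : ℝ) : ℂ) • (star g' * g') -
      star (resU U f • g') * (resU U f • g')
    have hd : 0 ≤ (transfer hσ ρ d x).re := by
      refine transfer_nonneg hσ ρ d x fun y => ?_
      have h1 : d y = (((‖f‖ ^ 2 - Complex.normSq (f y)) * Complex.normSq (g' y) : ℝ) : ℂ) := by
        simp only [d, CompactlySupportedContinuousMap.sub_apply,
          CompactlySupportedContinuousMap.smul_apply, CompactlySupportedContinuousMap.mul_apply,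
          CompactlySupportedContinuousMap.star_apply, CompactlySupportedContinuousMap.smulc_apply,
          resU, ContinuousMap.comp_apply, ContinuousMap.coe_mk, smul_eq_mul,
          Complex.ofReal_mul, Complex.ofReal_sub,
          Complex.normSq_eq_conj_mul_self, RCLike.star_def, map_mul]
        ring
      rw [h1, Complex.ofReal_re]
      refine mul_nonneg (sub_nonneg.2 ?_) (Complex.normSq_nonneg _)
      rw [Complex.normSq_eq_norm_sq]
      exact pow_le_pow_left₀ (norm_nonneg _) (f.norm_coe_le_norm _) 2
    simp only [d, map_sub, map_smul, ContinuousMap.sub_apply, ContinuousMap.smul_apply,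
      Complex.sub_re, smul_eq_mul, Complex.re_ofReal_mul, sub_nonneg] at hd
    exact hd
  rw [one_mul, mul_comm]
  refine (Real.sqrt_le_sqrt key).trans ?_
  rw [Real.sqrt_mul (by positivity), Real.sqrt_sq (norm_nonneg _)]
  exact mul_le_mul_of_nonneg_left (Real.sqrt_le_sqrt (re_preInner_le hσ ρ g x)) (norm_nonneg _)

theorem norm_preRight_le (g : PreM hσ ρ) (f : C(X, ℂ)) :
    ‖preRight hσ ρ g f‖ ≤ 1 * ‖g‖ * ‖f‖ := by
  have key : preInner hσ ρ (preRight hσ ρ g f) (preRight hσ ρ g f) =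
      preInner hσ ρ g g * (star f * f) := by
    let g' : C_c(U, ℂ) := (toPreM hσ ρ).symm g
    have h1 : star (alpha hσ f • g') * (alpha hσ f • g') =
        alpha hσ (star f * f) • (star g' * g') := by
      ext y
      simp [alpha]
      ring
    exact (congrArg (transfer hσ ρ) h1).trans (transfer_mul_alpha hσ ρ _ _)
  rw [one_mul, norm_preM, norm_preM, key]
  refine (Real.sqrt_le_sqrt (norm_mul_le _ _)).trans ?_
  rw [CStarRing.norm_star_mul_self, Real.sqrt_mul (norm_nonneg _),
    Real.sqrt_mul_self (norm_nonneg _)]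

/-- The Hilbert bimodule `M_ρ` over `C(X)`: the Hausdorff completion of `C_c(U)` for the seminorm
`‖g‖ = ‖L_ρ(g^* g)‖^{1/2}`. -/
abbrev M : Type _ := UniformSpace.Completion (PreM hσ ρ)

/-- The class `ĝ ∈ M_ρ` of `g ∈ C_c(U)`. -/
def hat (g : C_c(U, ℂ)) : M hσ ρ := (toPreM hσ ρ g : PreM hσ ρ)

/-- The inclusion of `C_c(U)` into `M_ρ` as a continuous linear map. -/
def incl : PreM hσ ρ →L[ℂ] M hσ ρ := UniformSpace.Completion.toComplL

theorem denseRange_incl : DenseRange (incl hσ ρ) := UniformSpace.Completion.denseRange_coe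

theorem isUniformInducing_incl : IsUniformInducing (incl hσ ρ) :=
  UniformSpace.Completion.isUniformInducing_coe _

/-- The left multiplication `φ_ρ : C(X) → L(M_ρ)`, determined by `φ_ρ(f) ĝ = (f g)^`. -/
def phi : C(X, ℂ) →L[ℂ] M hσ ρ →L[ℂ] M hσ ρ :=
  (((ContinuousLinearMap.compL ℂ C(X, ℂ) (PreM hσ ρ) (M hσ ρ) (incl hσ ρ)).comp
    ((preLeft hσ ρ).mkContinuous₂ 1 (norm_preLeft_le hσ ρ))).extend (incl hσ ρ)).flip

/-- The right action of `C(X)` on `M_ρ`, `rightMul m f = m f`, determined by `ĝ f = (g α(f))^`. -/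
def rightMul : M hσ ρ →L[ℂ] C(X, ℂ) →L[ℂ] M hσ ρ :=
  ((ContinuousLinearMap.compL ℂ C(X, ℂ) (PreM hσ ρ) (M hσ ρ) (incl hσ ρ)).comp
    ((preRight hσ ρ).mkContinuous₂ 1 (norm_preRight_le hσ ρ))).extend (incl hσ ρ)

/-- The `C(X)`-valued inner product of `M_ρ`, conjugate linear in the first variable, determined by
`⟨ĝ, ĥ⟩ = L_ρ(g^* h)`. -/
def innerM : M hσ ρ →L⋆[ℂ] M hσ ρ →L[ℂ] C(X, ℂ) :=
  (((((preInner hσ ρ).mkContinuous₂ 1 (norm_preInner_le hσ ρ)).extend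
    (incl hσ ρ)).flip).extend (incl hσ ρ)).flip

theorem phi_hat (f : C(X, ℂ)) (g : C_c(U, ℂ)) :
    phi hσ ρ f (hat hσ ρ g) = hat hσ ρ (resU U f • g) :=
  DFunLike.congr_fun (ContinuousLinearMap.extend_eq
    ((ContinuousLinearMap.compL ℂ C(X, ℂ) (PreM hσ ρ) (M hσ ρ) (incl hσ ρ)).comp
      ((preLeft hσ ρ).mkContinuous₂ 1 (norm_preLeft_le hσ ρ))) (denseRange_incl hσ ρ)
    (isUniformInducing_incl hσ ρ) (toPreM hσ ρ g)) f

theorem rightMul_hat (g : C_c(U, ℂ)) (f : C(X, ℂ)) :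
    rightMul hσ ρ (hat hσ ρ g) f = hat hσ ρ (alpha hσ f • g) :=
  DFunLike.congr_fun (ContinuousLinearMap.extend_eq _ (denseRange_incl hσ ρ)
    (isUniformInducing_incl hσ ρ) (toPreM hσ ρ g)) f

theorem innerM_hat (g h : C_c(U, ℂ)) :
    innerM hσ ρ (hat hσ ρ g) (hat hσ ρ h) = transfer hσ ρ (star g * h) := by
  have h1 := DFunLike.congr_fun (ContinuousLinearMap.extend_eq
    ((((preInner hσ ρ).mkContinuous₂ 1 (norm_preInner_le hσ ρ)).extend (incl hσ ρ)).flip)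
    (denseRange_incl hσ ρ) (isUniformInducing_incl hσ ρ) (toPreM hσ ρ h)) (hat hσ ρ g)
  refine h1.trans ?_
  exact DFunLike.congr_fun (ContinuousLinearMap.extend_eq
    ((preInner hσ ρ).mkContinuous₂ 1 (norm_preInner_le hσ ρ))
    (denseRange_incl hσ ρ) (isUniformInducing_incl hσ ρ) (toPreM hσ ρ g)) (toPreM hσ ρ h)

/-- `K(M_ρ)`: the closed linear span, in the operator norm, of the operators
`x ↦ m ⟨n, x⟩` with `m, n ∈ M_ρ`. -/
def compactOps : Submodule ℂ (M hσ ρ →L[ℂ] M hσ ρ) :=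
  (Submodule.span ℂ (Set.range fun p : M hσ ρ × M hσ ρ =>
    (rightMul hσ ρ p.1).comp (innerM hσ ρ p.2))).topologicalClosure

theorem dense_induction {p : M hσ ρ → Prop} (hp : IsClosed {m | p m})
    (h : ∀ g, p (hat hσ ρ g)) (m : M hσ ρ) : p m :=
  UniformSpace.Completion.induction_on m hp h

theorem phi_mul (a b : C(X, ℂ)) (m : M hσ ρ) :
    phi hσ ρ (a * b) m = phi hσ ρ a (phi hσ ρ b m) := by
  refine dense_induction hσ ρ (p := fun m => phi hσ ρ (a * b) m = phi hσ ρ a (phi hσ ρ b m))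
    (isClosed_eq (by fun_prop) (by fun_prop)) (fun g => ?_) m
  rw [phi_hat, phi_hat, phi_hat]
  congr 1
  ext y
  simp [resU, mul_assoc]

theorem phi_rightMul (a b : C(X, ℂ)) (m : M hσ ρ) :
    phi hσ ρ a (rightMul hσ ρ m b) = rightMul hσ ρ (phi hσ ρ a m) b := by
  refine dense_induction hσ ρ
    (p := fun m => phi hσ ρ a (rightMul hσ ρ m b) = rightMul hσ ρ (phi hσ ρ a m) b)
    (isClosed_eq (by fun_prop) (by fun_prop)) (fun g => ?_) m
  rw [rightMul_hat, phi_hat, phi_hat, rightMul_hat]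
  congr 1
  ext y
  simp [resU, alpha, mul_left_comm]

theorem phi_comp_mem_compactOps (a : C(X, ℂ)) {T : M hσ ρ →L[ℂ] M hσ ρ}
    (hT : T ∈ compactOps hσ ρ) : (phi hσ ρ a).comp T ∈ compactOps hσ ρ := by
  refine map_mem_closure (s := (Submodule.span ℂ (Set.range fun p : M hσ ρ × M hσ ρ =>
    (rightMul hσ ρ p.1).comp (innerM hσ ρ p.2)) : Set (M hσ ρ →L[ℂ] M hσ ρ)))
    (f := fun S => (phi hσ ρ a).comp S) (by fun_prop) hT ?_
  intro S hS
  induction hS using Submodule.span_induction with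
  | mem S hS =>
    obtain ⟨⟨m, n⟩, rfl⟩ := hS
    refine Submodule.subset_span ⟨(phi hσ ρ a m, n), ?_⟩
    ext x
    simp [phi_rightMul]
  | zero => simp
  | add x y _ _ hx hy =>
    simp only [ContinuousLinearMap.comp_add]; exact Submodule.add_mem _ hx hy
  | smul c x _ hx =>
    simp only [ContinuousLinearMap.comp_smul]; exact Submodule.smul_mem _ _ hx

/-- The closed ideal `φ_ρ⁻¹(K(M_ρ))` of `C(X)`. -/
def compactIdeal : Ideal C(X, ℂ) where
  carrier := {a | phi hσ ρ a ∈ compactOps hσ ρ}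
  add_mem' {a b} ha hb := by
    simpa only [Set.mem_ofPred_eq, map_add] using Submodule.add_mem _ ha hb
  zero_mem' := by simp
  smul_mem' c a ha := by
    have h : phi hσ ρ (c * a) = (phi hσ ρ c).comp (phi hσ ρ a) := by
      ext m
      exact phi_mul hσ ρ c a m
    simpa only [Set.mem_ofPred_eq, smul_eq_mul, h] using phi_comp_mem_compactOps hσ ρ c ha

theorem star_mem_compactIdeal {a : C(X, ℂ)} (ha : a ∈ compactIdeal hσ ρ) :
    star a ∈ compactIdeal hσ ρ := by
  have hcl : IsClosed (compactIdeal hσ ρ : Set C(X, ℂ)) :=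
    IsClosed.preimage (phi hσ ρ).continuous (Submodule.isClosed_topologicalClosure _)
  rw [← ContinuousMap.idealOfSet_ofIdeal_isClosed hcl, ContinuousMap.mem_idealOfSet] at ha ⊢
  intro x hx
  simp [ha hx]

end System

section Toeplitz

universe u

variable {X : Type u} [TopologicalSpace X] [CompactSpace X] [T2Space X]
  {U : TopologicalSpace.Opens X} {σ : U → X} (hσ : IsLocalHomeomorph σ) (ρ : C(U, ℝ≥0))

/-- A representation, in a `C^*`-algebra `B`, of the generators `C(X) ∪ M_ρ` subject to the relations
of the Toeplitz algebra: those of `C(X)`, those of `M_ρ`, the bimodule products, and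
`m^* n = ⟨m, n⟩`. -/
structure ToeplitzRep : Type (u + 1) where
  B : Type u
  [str : NonUnitalCStarAlgebra B]
  π : C(X, ℂ) →⋆ₙₐ[ℂ] B
  t : M hσ ρ →ₗ[ℂ] B
  left_mul : ∀ f m, π f * t m = t (phi hσ ρ f m)
  mul_right : ∀ m f, t m * π f = t (rightMul hσ ρ m f)
  star_mul : ∀ m n, star (t m) * t n = π (innerM hσ ρ m n)

instance (i : ToeplitzRep hσ ρ) : NonUnitalCStarAlgebra i.B := i.str

/-- The product, in the category of `C^*`-algebras, of all representations. -/
abbrev RepProd : Type (u + 1) := lp (fun i : ToeplitzRep hσ ρ => i.B) ∞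

/-- The universal representation of `f ∈ C(X)`. -/
def prodC (f : C(X, ℂ)) : RepProd hσ ρ :=
  ⟨fun i => i.π f, memℓp_infty ⟨‖f‖, by
    rintro _ ⟨i, rfl⟩
    exact NonUnitalStarAlgHom.norm_apply_le i.π f⟩⟩

/-- The universal representation of `m ∈ M_ρ`. -/
def prodM (m : M hσ ρ) : RepProd hσ ρ :=
  ⟨fun i => i.t m, memℓp_infty ⟨√‖innerM hσ ρ m m‖, by
    rintro _ ⟨i, rfl⟩
    refine Real.le_sqrt_of_sq_le ?_
    rw [pow_two, ← CStarRing.norm_star_mul_self, i.star_mul]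
    exact NonUnitalStarAlgHom.norm_apply_le i.π _⟩⟩

/-- The Toeplitz algebra as a `C^*`-subalgebra of the product of all representations. -/
def toeplitzSubalgebra : NonUnitalStarSubalgebra ℂ (RepProd hσ ρ) :=
  (NonUnitalStarAlgebra.adjoin ℂ
    (Set.range (prodC hσ ρ) ∪ Set.range (prodM hσ ρ))).topologicalClosure

instance : IsClosed (toeplitzSubalgebra hσ ρ : Set (RepProd hσ ρ)) :=
  NonUnitalStarSubalgebra.isClosed_topologicalClosure _

/-- The Toeplitz algebra `T(X, α, L_ρ)`: the universal `C^*`-algebra generated by `C(X) ∪ M_ρ` with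
the relations in `ToeplitzRep`. It is realized as the `C^*`-algebra generated by the universal
representation, the product of all representations. (A `C^*`-algebra generated by a representation is
a quotient of a set of sequences of noncommutative polynomials in `C(X) ∪ M_ρ`, so that the
representations in the universe of `X` account for all representations.) -/
abbrev Toeplitz : Type (u + 1) := toeplitzSubalgebra hσ ρ

/-- The element `f ∈ C(X)` of the Toeplitz algebra. -/
def toepC (f : C(X, ℂ)) : Toeplitz hσ ρ :=
  ⟨prodC hσ ρ f, NonUnitalStarSubalgebra.le_topologicalClosure _
    (NonUnitalStarAlgebra.subset_adjoin ℂ _ (Or.inl ⟨f, rfl⟩))⟩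

/-- The element `m ∈ M_ρ` of the Toeplitz algebra. -/
def toepM (m : M hσ ρ) : Toeplitz hσ ρ :=
  ⟨prodM hσ ρ m, NonUnitalStarSubalgebra.le_topologicalClosure _
    (NonUnitalStarAlgebra.subset_adjoin ℂ _ (Or.inr ⟨m, rfl⟩))⟩

/-- `K̂₁`, the closed linear span of the elements `m n^*` of the Toeplitz algebra,
`m, n ∈ M_ρ`. -/
def hatK : Submodule ℂ (Toeplitz hσ ρ) :=
  (Submodule.span ℂ (Set.range fun p : M hσ ρ × M hσ ρ =>
    toepM hσ ρ p.1 * star (toepM hσ ρ p.2))).topologicalClosure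

/-- A redundancy is a pair `(a, k)`, `a ∈ C(X)`, `k ∈ K̂₁`, with `a m = k m` for all `m ∈ M_ρ`. -/
def IsRedundancy (a : C(X, ℂ)) (k : Toeplitz hσ ρ) : Prop :=
  k ∈ hatK hσ ρ ∧ ∀ m, toepC hσ ρ a * toepM hσ ρ m = k * toepM hσ ρ m

/-- `ker(φ_ρ)^⊥ ∩ φ_ρ⁻¹(K(M_ρ))`. -/
def covIdeal : Set C(X, ℂ) :=
  {a | (∀ b, phi hσ ρ b = 0 → a * b = 0) ∧ a ∈ compactIdeal hσ ρ}

/-- The elements `a - k`, where `(a, k)` is a redundancy and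
`a ∈ ker(φ_ρ)^⊥ ∩ φ_ρ⁻¹(K(M_ρ))`. -/
def covElements : Set (Toeplitz hσ ρ) :=
  {d | ∃ a k, IsRedundancy hσ ρ a k ∧ a ∈ covIdeal hσ ρ ∧ d = toepC hσ ρ a - k}

/-- Closed two-sided ideals of the Toeplitz algebra. -/
structure IsClosedIdeal (J : Submodule ℂ (Toeplitz hσ ρ)) : Prop where
  isClosed : IsClosed (J : Set (Toeplitz hσ ρ))
  mul_mem_left : ∀ x y, y ∈ J → x * y ∈ J
  mul_mem_right : ∀ x y, x ∈ J → x * y ∈ J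

/-- The closed two-sided ideal of the Toeplitz algebra generated by `covElements`. -/
def covKernel : Submodule ℂ (Toeplitz hσ ρ) :=
  sInf {J | IsClosedIdeal hσ ρ J ∧ covElements hσ ρ ⊆ J}

theorem isClosedIdeal_covKernel : IsClosedIdeal hσ ρ (covKernel hσ ρ) where
  isClosed := by
    rw [covKernel, Submodule.coe_sInf]
    exact isClosed_biInter fun J hJ => hJ.1.isClosed
  mul_mem_left x y hy := by
    rw [covKernel, Submodule.mem_sInf] at hy ⊢
    exact fun J hJ => hJ.1.mul_mem_left x y (hy J hJ)
  mul_mem_right x y hx := by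
    rw [covKernel, Submodule.mem_sInf] at hx ⊢
    exact fun J hJ => hJ.1.mul_mem_right x y (hx J hJ)

theorem star_toepC (f : C(X, ℂ)) : star (toepC hσ ρ f) = toepC hσ ρ (star f) := by
  refine Subtype.ext (lp.ext (funext fun i => ?_))
  exact (map_star i.π f).symm

theorem toepC_mul_toepM (f : C(X, ℂ)) (m : M hσ ρ) :
    toepC hσ ρ f * toepM hσ ρ m = toepM hσ ρ (phi hσ ρ f m) :=
  Subtype.ext (lp.ext (funext fun i => i.left_mul f m))

theorem toepM_mul_toepC (m : M hσ ρ) (f : C(X, ℂ)) :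
    toepM hσ ρ m * toepC hσ ρ f = toepM hσ ρ (rightMul hσ ρ m f) :=
  Subtype.ext (lp.ext (funext fun i => i.mul_right m f))

theorem star_toepM_mul_toepM (m n : M hσ ρ) :
    star (toepM hσ ρ m) * toepM hσ ρ n = toepC hσ ρ (innerM hσ ρ m n) :=
  Subtype.ext (lp.ext (funext fun i => i.star_mul m n))

theorem star_mem_hatK {k : Toeplitz hσ ρ} (hk : k ∈ hatK hσ ρ) : star k ∈ hatK hσ ρ := by
  refine map_mem_closure (s := (Submodule.span ℂ (Set.range fun p : M hσ ρ × M hσ ρ =>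
    toepM hσ ρ p.1 * star (toepM hσ ρ p.2)) : Set (Toeplitz hσ ρ))) continuous_star hk ?_
  intro x hx
  induction hx using Submodule.span_induction with
  | mem x hx =>
    obtain ⟨⟨m, n⟩, rfl⟩ := hx
    exact Submodule.subset_span ⟨(n, m), by simp⟩
  | zero => simp
  | add x y _ _ hx hy => rw [star_add]; exact Submodule.add_mem _ hx hy
  | smul c x _ hx => rw [star_smul]; exact Submodule.smul_mem _ _ hx

/-- `K̂₁ M_ρ` lies in the closed linear span of `M_ρ`. -/
theorem hatK_mul_toepM_mem {k : Toeplitz hσ ρ} (hk : k ∈ hatK hσ ρ) (m : M hσ ρ) :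
    k * toepM hσ ρ m ∈ (Submodule.span ℂ (Set.range (toepM hσ ρ))).topologicalClosure := by
  refine map_mem_closure (s := (Submodule.span ℂ (Set.range fun p : M hσ ρ × M hσ ρ =>
    toepM hσ ρ p.1 * star (toepM hσ ρ p.2)) : Set (Toeplitz hσ ρ)))
    (f := fun x => x * toepM hσ ρ m) (by fun_prop) hk ?_
  intro x hx
  induction hx using Submodule.span_induction with
  | mem x hx =>
    obtain ⟨⟨p, q⟩, rfl⟩ := hx
    refine Submodule.subset_span ⟨rightMul hσ ρ p (innerM hσ ρ q m), ?_⟩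
    simp only [mul_assoc, star_toepM_mul_toepM, toepM_mul_toepC]
  | zero => simp
  | add x y _ _ hx hy => simp only [add_mul]; exact Submodule.add_mem _ hx hy
  | smul c x _ hx => simp only [smul_mul_assoc]; exact Submodule.smul_mem _ _ hx

theorem IsRedundancy.star {a : C(X, ℂ)} {k : Toeplitz hσ ρ} (h : IsRedundancy hσ ρ a k) :
    IsRedundancy hσ ρ (star a) (star k) := by
  refine ⟨star_mem_hatK hσ ρ h.1, fun m => ?_⟩
  set d := toepC hσ ρ a - k with hd
  have hdm : ∀ n, d * toepM hσ ρ n = 0 := fun n => by rw [hd, sub_mul, h.2 n, sub_self]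
  have hds : ∀ x ∈ (Submodule.span ℂ (Set.range (toepM hσ ρ))).topologicalClosure,
      d * x = 0 := by
    intro x hx
    have hcl : IsClosed {x : Toeplitz hσ ρ | d * x = 0} :=
      isClosed_eq (by fun_prop) continuous_const
    refine closure_minimal ?_ hcl hx
    intro y hy
    induction hy using Submodule.span_induction with
    | mem y hy => obtain ⟨n, rfl⟩ := hy; exact hdm n
    | zero => simp
    | add x y _ _ hx hy =>
      simp only [Set.mem_ofPred_eq] at hx hy ⊢
      rw [mul_add, hx, hy, add_zero]
    | smul c x _ hx =>
      simp only [Set.mem_ofPred_eq] at hx ⊢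
      rw [mul_smul_comm, hx, smul_zero]
  have hmem : Star.star d * toepM hσ ρ m ∈
      (Submodule.span ℂ (Set.range (toepM hσ ρ))).topologicalClosure := by
    rw [hd, star_sub, star_toepC, sub_mul, toepC_mul_toepM]
    exact Submodule.sub_mem _
      (Submodule.le_topologicalClosure _ (Submodule.subset_span ⟨_, rfl⟩))
      (hatK_mul_toepM_mem hσ ρ (star_mem_hatK hσ ρ h.1) m)
  have h0 : Star.star d * toepM hσ ρ m = 0 := by
    rw [← CStarRing.star_mul_self_eq_zero_iff, StarMul.star_mul, star_star, mul_assoc,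
      hds _ hmem, mul_zero]
  rw [hd, star_sub, star_toepC, sub_mul, sub_eq_zero] at h0
  exact h0

theorem star_mem_covIdeal {a : C(X, ℂ)} (ha : a ∈ covIdeal hσ ρ) : star a ∈ covIdeal hσ ρ := by
  refine ⟨fun b hb => ?_, star_mem_compactIdeal hσ ρ ha.2⟩
  have h := ha.1 b hb
  ext x
  have hx := DFunLike.congr_fun h x
  simp only [ContinuousMap.mul_apply, ContinuousMap.zero_apply, mul_eq_zero] at hx
  rcases hx with hx | hx <;> simp [hx]

theorem star_mem_covElements {d : Toeplitz hσ ρ} (hd : d ∈ covElements hσ ρ) :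
    star d ∈ covElements hσ ρ := by
  obtain ⟨a, k, h, ha, rfl⟩ := hd
  exact ⟨star a, star k, h.star, star_mem_covIdeal hσ ρ ha, by rw [star_sub, star_toepC]⟩

theorem star_mem_covKernel {x : Toeplitz hσ ρ} (hx : x ∈ covKernel hσ ρ) :
    star x ∈ covKernel hσ ρ := by
  rw [covKernel, Submodule.mem_sInf] at hx ⊢
  rintro J ⟨hJ, hJ'⟩
  let J' : Submodule ℂ (Toeplitz hσ ρ) :=
    { carrier := {y | star y ∈ J}
      add_mem' := fun {a b} ha hb => by
        simpa only [Set.mem_ofPred_eq, star_add] using J.add_mem ha hb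
      zero_mem' := by simp
      smul_mem' := fun c a ha => by
        simpa only [Set.mem_ofPred_eq, star_smul] using J.smul_mem _ ha }
  refine hx J' ⟨⟨hJ.isClosed.preimage continuous_star, ?_, ?_⟩, ?_⟩
  · intro a b hb
    have : star (a * b) ∈ J := by rw [star_mul]; exact hJ.mul_mem_right _ _ hb
    exact this
  · intro a b hb
    have : star (a * b) ∈ J := by rw [star_mul]; exact hJ.mul_mem_left _ _ hb
    exact this
  · exact fun d hd => hJ' (star_mem_covElements hσ ρ hd)

/-- The crossed product by a partial endomorphism `O(X, α, L_ρ)`: the quotient of the Toeplitz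
algebra by the closed two-sided ideal generated by the elements `a - k`, where `(a, k)` is a
redundancy and `a ∈ ker(φ_ρ)^⊥ ∩ φ_ρ⁻¹(K(M_ρ))`. -/
def CrossedProduct : Type (u + 1) := Toeplitz hσ ρ ⧸ covKernel hσ ρ

instance : IsClosed ((covKernel hσ ρ : Submodule ℂ (Toeplitz hσ ρ)) : Set (Toeplitz hσ ρ)) :=
  (isClosedIdeal_covKernel hσ ρ).isClosed

/-- The quotient norm. -/
instance : NormedAddCommGroup (CrossedProduct hσ ρ) :=
  inferInstanceAs (NormedAddCommGroup (Toeplitz hσ ρ ⧸ covKernel hσ ρ))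

instance : NormedSpace ℂ (CrossedProduct hσ ρ) :=
  inferInstanceAs (NormedSpace ℂ (Toeplitz hσ ρ ⧸ covKernel hσ ρ))

/-- The quotient map of the Toeplitz algebra onto the crossed product. -/
def toCrossedProduct : Toeplitz hσ ρ →ₗ[ℂ] CrossedProduct hσ ρ := (covKernel hσ ρ).mkQ

theorem toCrossedProduct_surjective : Function.Surjective (toCrossedProduct hσ ρ) :=
  Submodule.mkQ_surjective _

theorem toCrossedProduct_eq_iff {x y : Toeplitz hσ ρ} :
    toCrossedProduct hσ ρ x = toCrossedProduct hσ ρ y ↔ x - y ∈ covKernel hσ ρ :=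
  Submodule.Quotient.eq _

instance : Mul (CrossedProduct hσ ρ) where
  mul := Quotient.map₂ (· * ·) (by
    intro a a' ha b b' hb
    have ha' : a - a' ∈ covKernel hσ ρ := (Submodule.quotientRel_def _).1 ha
    have hb' : b - b' ∈ covKernel hσ ρ := (Submodule.quotientRel_def _).1 hb
    refine (Submodule.quotientRel_def _).2 ?_
    have : a * b - a' * b' = (a - a') * b + a' * (b - b') := by
      rw [sub_mul, mul_sub]; abel
    rw [this]
    exact Submodule.add_mem _ ((isClosedIdeal_covKernel hσ ρ).mul_mem_right _ _ ha')
      ((isClosedIdeal_covKernel hσ ρ).mul_mem_left _ _ hb'))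

instance : Star (CrossedProduct hσ ρ) where
  star := Quotient.map star (by
    intro a a' ha
    have ha' : a - a' ∈ covKernel hσ ρ := (Submodule.quotientRel_def _).1 ha
    refine (Submodule.quotientRel_def _).2 ?_
    have h := star_mem_covKernel hσ ρ ha'
    rw [star_sub] at h
    exact h)

theorem toCrossedProduct_mul (x y : Toeplitz hσ ρ) : toCrossedProduct hσ ρ (x * y) =
    toCrossedProduct hσ ρ x * toCrossedProduct hσ ρ y := rfl

theorem toCrossedProduct_star (x : Toeplitz hσ ρ) :
    toCrossedProduct hσ ρ (star x) = star (toCrossedProduct hσ ρ x) := rfl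

instance : NonUnitalRing (CrossedProduct hσ ρ) where
  __ := (inferInstance : AddCommGroup (CrossedProduct hσ ρ))
  __ := (inferInstance : Mul (CrossedProduct hσ ρ))
  left_distrib a b c := by
    obtain ⟨a, rfl⟩ := toCrossedProduct_surjective hσ ρ a
    obtain ⟨b, rfl⟩ := toCrossedProduct_surjective hσ ρ b
    obtain ⟨c, rfl⟩ := toCrossedProduct_surjective hσ ρ c
    exact congrArg (toCrossedProduct hσ ρ) (mul_add a b c)
  right_distrib a b c := by
    obtain ⟨a, rfl⟩ := toCrossedProduct_surjective hσ ρ a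
    obtain ⟨b, rfl⟩ := toCrossedProduct_surjective hσ ρ b
    obtain ⟨c, rfl⟩ := toCrossedProduct_surjective hσ ρ c
    exact congrArg (toCrossedProduct hσ ρ) (add_mul a b c)
  zero_mul a := by
    obtain ⟨a, rfl⟩ := toCrossedProduct_surjective hσ ρ a
    exact congrArg (toCrossedProduct hσ ρ) (zero_mul a)
  mul_zero a := by
    obtain ⟨a, rfl⟩ := toCrossedProduct_surjective hσ ρ a
    exact congrArg (toCrossedProduct hσ ρ) (mul_zero a)
  mul_assoc a b c := by
    obtain ⟨a, rfl⟩ := toCrossedProduct_surjective hσ ρ a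
    obtain ⟨b, rfl⟩ := toCrossedProduct_surjective hσ ρ b
    obtain ⟨c, rfl⟩ := toCrossedProduct_surjective hσ ρ c
    exact congrArg (toCrossedProduct hσ ρ) (mul_assoc a b c)

instance : StarRing (CrossedProduct hσ ρ) where
  star_involutive a := by
    obtain ⟨a, rfl⟩ := toCrossedProduct_surjective hσ ρ a
    exact congrArg (toCrossedProduct hσ ρ) (star_star a)
  star_mul a b := by
    obtain ⟨a, rfl⟩ := toCrossedProduct_surjective hσ ρ a
    obtain ⟨b, rfl⟩ := toCrossedProduct_surjective hσ ρ b
    exact congrArg (toCrossedProduct hσ ρ) (star_mul a b)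
  star_add a b := by
    obtain ⟨a, rfl⟩ := toCrossedProduct_surjective hσ ρ a
    obtain ⟨b, rfl⟩ := toCrossedProduct_surjective hσ ρ b
    exact congrArg (toCrossedProduct hσ ρ) (star_add a b)

/-- The canonical image of `f ∈ C(X)` in the crossed product. -/
def ofC (f : C(X, ℂ)) : CrossedProduct hσ ρ := toCrossedProduct hσ ρ (toepC hσ ρ f)

/-- The canonical image of `m ∈ M_ρ` in the crossed product. -/
def ofM (m : M hσ ρ) : CrossedProduct hσ ρ := toCrossedProduct hσ ρ (toepM hσ ρ m)

end Toeplitz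

/-- The function `√|r| ∈ C(U)` for `r ∈ C(U)`; it is `√r` wherever `r` is positive, and
`ρ = r ρ'` with `ρ, ρ' ≥ 0` forces `r > 0` at all points where `r ≠ 0` and `ρ' ≠ 0`. -/
def sqrtAbs {Y : Type*} [TopologicalSpace Y] (r : C(Y, ℂ)) : C(Y, ℂ) where
  toFun y := ((√‖r y‖ : ℝ) : ℂ)
  continuous_toFun := by fun_prop

end PartialCrossedProduct

end

open PartialCrossedProduct

/-! Put `s = √|r|`. Since `ρ` and `ρ'` are nonnegative, taking absolute values in `ρ = r ρ'` gives
`ρ = |r| ρ' = |s|² ρ'`. Hence `L_ρ'((s g)^* (s h)) = L_ρ(g^* h)`: multiplication by `s` on `C_c(U)`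
preserves the `C(X)`-valued forms (`preInner_preScale`), so it is isometric and extends to the
completions even if `s` is unbounded on `U`. It commutes with both actions of `C(X)`, which are
pointwise multiplications. As `r` vanishes nowhere, `1/s` is continuous and gives the inverse in the
same way. Thus `M_ρ` and `M_ρ'` are isomorphic Hilbert bimodules (`scaleIso`).

The rest is functoriality: the crossed product is built from the bimodule alone. Pulling
representations back along a bimodule isomorphism `V` yields a homomorphism of Toeplitz algebras
that fixes `C(X)` and sends `m` to `V m`. It respects `K̂₁`, redundancies and the ideal `ker(φ)^⊥ ∩
φ⁻¹(K)`, hence also the ideals divided out (`covKernel_le_comap`). The inverse of `V` induces the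
inverse homomorphism, so both descend to mutually inverse maps of the quotients. -/

noncomputable section

namespace PartialCrossedProduct

universe u

/-! ### Isomorphisms of Hilbert bimodules and their compact operators -/

section Bimodule

variable {X : Type*} [TopologicalSpace X] [CompactSpace X] [T2Space X]
  {U : TopologicalSpace.Opens X} {σ : U → X} {hσ : IsLocalHomeomorph σ} {ρ ρ' : C(U, ℝ≥0)}

/-- An isomorphism of the Hilbert bimodules `M_ρ` and `M_ρ'` over `C(X)`. -/
structure BimoduleIso (hσ : IsLocalHomeomorph σ) (ρ ρ' : C(U, ℝ≥0)) where
  toEquiv : M hσ ρ ≃L[ℂ] M hσ ρ'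
  map_phi : ∀ f m, toEquiv (phi hσ ρ f m) = phi hσ ρ' f (toEquiv m)
  map_rightMul : ∀ m f, toEquiv (rightMul hσ ρ m f) = rightMul hσ ρ' (toEquiv m) f
  innerM_map : ∀ m n, innerM hσ ρ' (toEquiv m) (toEquiv n) = innerM hσ ρ m n

namespace BimoduleIso

/-- The inverse of an isomorphism of Hilbert bimodules. -/
def symm (V : BimoduleIso hσ ρ ρ') : BimoduleIso hσ ρ' ρ where
  toEquiv := V.toEquiv.symm
  map_phi f m := by
    rw [ContinuousLinearEquiv.symm_apply_eq, V.map_phi, V.toEquiv.apply_symm_apply]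
  map_rightMul m f := by
    rw [ContinuousLinearEquiv.symm_apply_eq, V.map_rightMul, V.toEquiv.apply_symm_apply]
  innerM_map m n := by
    rw [← V.innerM_map, V.toEquiv.apply_symm_apply, V.toEquiv.apply_symm_apply]

@[simp] theorem symm_toEquiv (V : BimoduleIso hσ ρ ρ') : V.symm.toEquiv = V.toEquiv.symm := rfl

/-- Conjugation by `V` turns the rank-one operator of `(m, n)` into that of `(V m, V n)`. Being
linear and continuous, it then respects the closed spans. -/
theorem conj_mem_compactOps (V : BimoduleIso hσ ρ ρ') {T : M hσ ρ →L[ℂ] M hσ ρ}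
    (hT : T ∈ compactOps hσ ρ) :
    (V.toEquiv : M hσ ρ →L[ℂ] M hσ ρ').comp
      (T.comp (V.toEquiv.symm : M hσ ρ' →L[ℂ] M hσ ρ)) ∈ compactOps hσ ρ' := by
  refine map_mem_closure (s := (Submodule.span ℂ (Set.range fun p : M hσ ρ × M hσ ρ =>
    (rightMul hσ ρ p.1).comp (innerM hσ ρ p.2)) : Set (M hσ ρ →L[ℂ] M hσ ρ)))
    (f := fun S => (V.toEquiv : M hσ ρ →L[ℂ] M hσ ρ').comp
      (S.comp (V.toEquiv.symm : M hσ ρ' →L[ℂ] M hσ ρ))) (by fun_prop) hT ?_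
  intro S hS
  induction hS using Submodule.span_induction with
  | mem S hS =>
    obtain ⟨⟨m, n⟩, rfl⟩ := hS
    refine Submodule.subset_span ⟨(V.toEquiv m, V.toEquiv n), ?_⟩
    ext x
    -- The inverse of `V` is its adjoint.
    have h : innerM hσ ρ n (V.toEquiv.symm x) = innerM hσ ρ' (V.toEquiv n) x := by
      rw [← V.innerM_map, V.toEquiv.apply_symm_apply]
    simp [V.map_rightMul, h]
  | zero => simp
  | add x y _ _ hx hy =>
    simp only [ContinuousLinearMap.add_comp, ContinuousLinearMap.comp_add]
    exact Submodule.add_mem _ hx hy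
  | smul c x _ hx =>
    simp only [ContinuousLinearMap.smul_comp, ContinuousLinearMap.comp_smul]
    exact Submodule.smul_mem _ _ hx

/-- Intertwining the left actions means `φ_ρ'(a) = V φ_ρ(a) V⁻¹`, so compactness is transported. -/
theorem compactIdeal_le (V : BimoduleIso hσ ρ ρ') : compactIdeal hσ ρ ≤ compactIdeal hσ ρ' := by
  intro a ha
  have h : phi hσ ρ' a = (V.toEquiv : M hσ ρ →L[ℂ] M hσ ρ').comp
      ((phi hσ ρ a).comp (V.toEquiv.symm : M hσ ρ' →L[ℂ] M hσ ρ)) := by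
    ext x
    simp [V.map_phi]
  change phi hσ ρ' a ∈ compactOps hσ ρ'
  rw [h]
  exact V.conj_mem_compactOps ha

/-- The kernels are compared from `ρ'` back to `ρ` because annihilators reverse inclusions: this is
the direction that carries `ker(φ_ρ)^⊥` into `ker(φ_ρ')^⊥`. -/
theorem phi_eq_zero (V : BimoduleIso hσ ρ ρ') {b : C(X, ℂ)} (hb : phi hσ ρ' b = 0) :
    phi hσ ρ b = 0 := by
  ext m
  apply V.toEquiv.injective
  simp [V.map_phi, hb]

end BimoduleIso

/-! ### Multiplication by a function with `ρ = |s|² ρ'` -/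

theorem transfer_congr {f g : C_c(U, ℂ)}
    (h : ∀ y, ((ρ y : ℝ) : ℂ) * f y = ((ρ' y : ℝ) : ℂ) * g y) :
    transfer hσ ρ f = transfer hσ ρ' g := by
  ext x
  rw [transfer_apply, transfer_apply]
  exact finsum_mem_congr rfl fun y _ => h y

variable (hσ) in
/-- The linear map `g ↦ s g` from `C_c(U)` with the seminorm given by `ρ` to `C_c(U)` with the
seminorm given by `ρ'`. -/
def preScale (ρ ρ' : C(U, ℝ≥0)) (s : C(U, ℂ)) : PreM hσ ρ →ₗ[ℂ] PreM hσ ρ' where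
  toFun g := toPreM hσ ρ' (s • (toPreM hσ ρ).symm g)
  map_add' _ _ := CompactlySupportedContinuousMap.ext fun _ => mul_add (_ : ℂ) _ _
  map_smul' _ _ := CompactlySupportedContinuousMap.ext fun _ => mul_left_comm (_ : ℂ) _ _

/-- The factor `|s|²` produced by `(s g)^* (s h)` is absorbed into the weight, and a transfer
operator sees only the product of weight and function. -/
theorem preInner_preScale {s : C(U, ℂ)}
    (hs : ∀ y, ((ρ y : ℝ) : ℂ) = star (s y) * s y * ((ρ' y : ℝ) : ℂ)) (g h : PreM hσ ρ) :
    preInner hσ ρ' (preScale hσ ρ ρ' s g) (preScale hσ ρ ρ' s h) = preInner hσ ρ g h := by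
  let g' : C_c(U, ℂ) := (toPreM hσ ρ).symm g
  let h' : C_c(U, ℂ) := (toPreM hσ ρ).symm h
  change transfer hσ ρ' (star (s • g') * (s • h')) = transfer hσ ρ (star g' * h')
  refine transfer_congr fun y => ?_
  rw [hs y]
  simp
  ring

/-- The seminorms come from the forms, so no bound on `s` is needed to extend to the completions. -/
theorem norm_preScale {s : C(U, ℂ)}
    (hs : ∀ y, ((ρ y : ℝ) : ℂ) = star (s y) * s y * ((ρ' y : ℝ) : ℂ)) (g : PreM hσ ρ) :
    ‖preScale hσ ρ ρ' s g‖ = ‖g‖ := by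
  rw [norm_preM, norm_preM, preInner_preScale hs]

/-- If `ρ = |s|² ρ'`, then multiplication by `s` extends to a map from `M_ρ` to `M_ρ'`. -/
def scale {s : C(U, ℂ)}
    (hs : ∀ y, ((ρ y : ℝ) : ℂ) = star (s y) * s y * ((ρ' y : ℝ) : ℂ)) :
    M hσ ρ →L[ℂ] M hσ ρ' :=
  ((incl hσ ρ').comp ((preScale hσ ρ ρ' s).mkContinuous 1
    fun g => by rw [norm_preScale hs, one_mul])).extend (incl hσ ρ)

theorem scale_hat {s : C(U, ℂ)}
    (hs : ∀ y, ((ρ y : ℝ) : ℂ) = star (s y) * s y * ((ρ' y : ℝ) : ℂ)) (g : C_c(U, ℂ)) :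
    scale (hσ := hσ) hs (hat hσ ρ g) = hat hσ ρ' (s • g) :=
  ContinuousLinearMap.extend_eq _ (denseRange_incl hσ ρ) (isUniformInducing_incl hσ ρ)
    (toPreM hσ ρ g)

theorem scale_scale {s s' : C(U, ℂ)}
    (hs : ∀ y, ((ρ y : ℝ) : ℂ) = star (s y) * s y * ((ρ' y : ℝ) : ℂ))
    (hs' : ∀ y, ((ρ' y : ℝ) : ℂ) = star (s' y) * s' y * ((ρ y : ℝ) : ℂ))
    (h : ∀ y, s' y * s y = 1) (m : M hσ ρ) :
    scale (hσ := hσ) hs' (scale hs m) = m := by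
  refine dense_induction hσ ρ (p := fun m => scale (hσ := hσ) hs' (scale hs m) = m)
    (isClosed_eq (by fun_prop) continuous_id) (fun g => ?_) m
  rw [scale_hat, scale_hat]
  congr 1
  ext y
  simp [← mul_assoc, h y]

/-- If `ρ = |s|² ρ'` with `s` invertible, then multiplication by `s` is an isomorphism of Hilbert
bimodules from `M_ρ` to `M_ρ'`. -/
def scaleIso {s s' : C(U, ℂ)}
    (hs : ∀ y, ((ρ y : ℝ) : ℂ) = star (s y) * s y * ((ρ' y : ℝ) : ℂ))
    (hs' : ∀ y, ((ρ' y : ℝ) : ℂ) = star (s' y) * s' y * ((ρ y : ℝ) : ℂ))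
    (h : ∀ y, s' y * s y = 1) : BimoduleIso hσ ρ ρ' where
  toEquiv := ContinuousLinearEquiv.equivOfInverse (scale hs) (scale hs')
    (scale_scale hs hs' h) (scale_scale hs' hs fun y => by rw [mul_comm, h])
  map_phi f m := by
    refine dense_induction hσ ρ
      (p := fun m => scale hs (phi hσ ρ f m) = phi hσ ρ' f (scale hs m))
      (isClosed_eq (by fun_prop) (by fun_prop)) (fun g => ?_) m
    rw [phi_hat, scale_hat, scale_hat, phi_hat]
    congr 1
    ext y
    simp [resU, mul_left_comm]
  map_rightMul m f := by
    refine dense_induction hσ ρ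
      (p := fun m => scale hs (rightMul hσ ρ m f) = rightMul hσ ρ' (scale hs m) f)
      (isClosed_eq (by fun_prop) (by fun_prop)) (fun g => ?_) m
    rw [rightMul_hat, scale_hat, scale_hat, rightMul_hat]
    congr 1
    ext y
    simp [alpha, mul_left_comm]
  innerM_map m n := by
    -- Both sides are continuous in each variable separately, so density is used first in `m` with
    -- `n` fixed, then in `n`.
    refine dense_induction hσ ρ
      (p := fun m => innerM hσ ρ' (scale hs m) (scale hs n) = innerM hσ ρ m n)
      (isClosed_eq (by fun_prop) (by fun_prop)) (fun g => ?_) m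
    refine dense_induction hσ ρ
      (p := fun n => innerM hσ ρ' (scale hs (hat hσ ρ g)) (scale hs n) =
        innerM hσ ρ (hat hσ ρ g) n)
      (isClosed_eq (by fun_prop) (by fun_prop)) (fun g' => ?_) n
    rw [scale_hat, scale_hat, innerM_hat, innerM_hat]
    exact preInner_preScale hs (toPreM hσ ρ g) (toPreM hσ ρ g')

end Bimodule

/-! ### Functoriality of the Toeplitz algebra -/

section Functoriality

variable {X : Type u} [TopologicalSpace X] [CompactSpace X] [T2Space X]
  {U : TopologicalSpace.Opens X} {σ : U → X} {hσ : IsLocalHomeomorph σ} {ρ ρ' : C(U, ℝ≥0)}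

/-- The restriction of a representation along an isomorphism of Hilbert bimodules. -/
@[reducible] def ToeplitzRep.comap (V : BimoduleIso hσ ρ ρ') (i : ToeplitzRep hσ ρ') :
    ToeplitzRep hσ ρ where
  B := i.B
  π := i.π
  t := i.t ∘ₗ (V.toEquiv : M hσ ρ →ₗ[ℂ] M hσ ρ')
  left_mul f m := by simp [i.left_mul, V.map_phi]
  mul_right m f := by simp [i.mul_right, V.map_rightMul]
  star_mul m n := by simp [i.star_mul, V.innerM_map]

/-- The homomorphism between the products of all representations of `M_ρ` and `M_ρ'` induced by an
isomorphism of Hilbert bimodules. -/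
def repProdMap (V : BimoduleIso hσ ρ ρ') : RepProd hσ ρ →⋆ₙₐ[ℂ] RepProd hσ ρ' where
  toFun x := ⟨fun j => x (j.comap V), memℓp_infty ⟨‖x‖, by
    rintro _ ⟨j, rfl⟩
    exact lp.norm_apply_le_norm ENNReal.top_ne_zero x (j.comap V)⟩⟩
  map_smul' _ _ := rfl
  map_zero' := rfl
  map_add' _ _ := rfl
  map_mul' _ _ := rfl
  map_star' _ := rfl

theorem repProdMap_prodM (V : BimoduleIso hσ ρ ρ') (m : M hσ ρ) :
    repProdMap V (prodM hσ ρ m) = prodM hσ ρ' (V.toEquiv m) := rfl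

/-- The coordinates of the image are among the coordinates of `x`. -/
theorem norm_repProdMap_le (V : BimoduleIso hσ ρ ρ') (x : RepProd hσ ρ) :
    ‖repProdMap V x‖ ≤ ‖x‖ :=
  lp.norm_le_of_forall_le (norm_nonneg _) fun j =>
    lp.norm_apply_le_norm ENNReal.top_ne_zero x (j.comap V)

theorem continuous_repProdMap (V : BimoduleIso hσ ρ ρ') : Continuous (repProdMap V) :=
  AddMonoidHomClass.continuous_of_bound (repProdMap V) 1 fun x => by
    rw [one_mul]
    exact norm_repProdMap_le V x

/-- Generators go to generators, so the generated `*`-subalgebra is preserved; continuity handles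
its closure. -/
theorem repProdMap_mem (V : BimoduleIso hσ ρ ρ') {x : RepProd hσ ρ}
    (hx : x ∈ toeplitzSubalgebra hσ ρ) : repProdMap V x ∈ toeplitzSubalgebra hσ ρ' := by
  refine map_mem_closure (continuous_repProdMap V) hx fun y hy => ?_
  have h : NonUnitalStarAlgebra.adjoin ℂ (Set.range (prodC hσ ρ) ∪ Set.range (prodM hσ ρ)) ≤
      (NonUnitalStarAlgebra.adjoin ℂ
        (Set.range (prodC hσ ρ') ∪ Set.range (prodM hσ ρ'))).comap (repProdMap V) := by
    refine NonUnitalStarAlgebra.adjoin_le ?_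
    rintro _ (⟨f, rfl⟩ | ⟨m, rfl⟩)
    · exact NonUnitalStarAlgebra.subset_adjoin ℂ _ (Or.inl ⟨f, rfl⟩)
    · exact NonUnitalStarAlgebra.subset_adjoin ℂ _ (Or.inr ⟨V.toEquiv m, rfl⟩)
  exact h hy

/-- The homomorphism of Toeplitz algebras induced by an isomorphism of Hilbert bimodules. -/
def toeplitzMap (V : BimoduleIso hσ ρ ρ') : Toeplitz hσ ρ →⋆ₙₐ[ℂ] Toeplitz hσ ρ' where
  toFun x := ⟨repProdMap V x, repProdMap_mem V x.2⟩
  map_smul' _ _ := rfl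
  map_zero' := rfl
  map_add' _ _ := rfl
  map_mul' _ _ := rfl
  map_star' _ := rfl

theorem continuous_toeplitzMap (V : BimoduleIso hσ ρ ρ') : Continuous (toeplitzMap V) :=
  ((continuous_repProdMap V).comp continuous_subtype_val).subtype_mk _

/-- The linear map underlying `toeplitzMap`. -/
def toeplitzLinearMap (V : BimoduleIso hσ ρ ρ') : Toeplitz hσ ρ →ₗ[ℂ] Toeplitz hσ ρ' where
  toFun := toeplitzMap V
  map_add' := map_add _
  map_smul' := map_smul _

theorem toeplitzMap_toepC (V : BimoduleIso hσ ρ ρ') (f : C(X, ℂ)) :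
    toeplitzMap V (toepC hσ ρ f) = toepC hσ ρ' f := rfl

theorem toeplitzMap_toepM (V : BimoduleIso hσ ρ ρ') (m : M hσ ρ) :
    toeplitzMap V (toepM hσ ρ m) = toepM hσ ρ' (V.toEquiv m) := rfl

/-- The composite and the identity are continuous homomorphisms, so agreement on generators
suffices. This avoids comparing a representation with its pullback along `V` and `V⁻¹`, whose `M_ρ`
part is not definitionally the original one. -/
theorem toeplitzMap_symm_toeplitzMap (V : BimoduleIso hσ ρ ρ') (x : Toeplitz hσ ρ) :
    toeplitzMap V.symm (toeplitzMap V x) = x := by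
  refine Subtype.ext ?_
  change repProdMap V.symm (repProdMap V (x : RepProd hσ ρ)) = x
  have hcl : IsClosed {y : RepProd hσ ρ | repProdMap V.symm (repProdMap V y) = y} :=
    isClosed_eq ((continuous_repProdMap V.symm).comp (continuous_repProdMap V)) continuous_id
  refine closure_minimal (fun y hy => ?_) hcl x.2
  have h : NonUnitalStarAlgebra.adjoin ℂ (Set.range (prodC hσ ρ) ∪ Set.range (prodM hσ ρ)) ≤
      NonUnitalStarAlgHom.equalizer ((repProdMap V.symm).comp (repProdMap V))
        (NonUnitalStarAlgHom.id ℂ (RepProd hσ ρ)) := by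
    refine NonUnitalStarAlgebra.adjoin_le ?_
    rintro _ (⟨f, rfl⟩ | ⟨m, rfl⟩)
    · rfl
    · change repProdMap V.symm (repProdMap V (prodM hσ ρ m)) = prodM hσ ρ m
      rw [repProdMap_prodM, repProdMap_prodM, BimoduleIso.symm_toEquiv,
        V.toEquiv.symm_apply_apply]
  exact h hy

/-! ### Redundancies and passage to the crossed products -/

theorem toeplitzMap_mem_hatK (V : BimoduleIso hσ ρ ρ') {k : Toeplitz hσ ρ}
    (hk : k ∈ hatK hσ ρ) : toeplitzMap V k ∈ hatK hσ ρ' := by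
  refine map_mem_closure (continuous_toeplitzMap V) hk fun x hx => ?_
  induction hx using Submodule.span_induction with
  | mem x hx =>
    obtain ⟨⟨m, n⟩, rfl⟩ := hx
    exact Submodule.subset_span ⟨(V.toEquiv m, V.toEquiv n), rfl⟩
  | zero => simp
  | add x y _ _ hx hy => rw [map_add]; exact Submodule.add_mem _ hx hy
  | smul c x _ hx => rw [map_smul]; exact Submodule.smul_mem _ _ hx

/-- Surjectivity of `V` matters here: the identity must be tested on all of `M_ρ'`, and each of its
elements is the image of one where the original redundancy applies. -/
theorem IsRedundancy.map (V : BimoduleIso hσ ρ ρ') {a : C(X, ℂ)} {k : Toeplitz hσ ρ}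
    (h : IsRedundancy hσ ρ a k) : IsRedundancy hσ ρ' a (toeplitzMap V k) := by
  refine ⟨toeplitzMap_mem_hatK V h.1, fun m => ?_⟩
  have hm := congrArg (toeplitzMap V) (h.2 (V.toEquiv.symm m))
  rwa [map_mul, map_mul, toeplitzMap_toepC, toeplitzMap_toepM,
    V.toEquiv.apply_symm_apply] at hm

theorem covIdeal_subset (V : BimoduleIso hσ ρ ρ') : covIdeal hσ ρ ⊆ covIdeal hσ ρ' :=
  fun _ ha => ⟨fun b hb => ha.1 b (V.phi_eq_zero hb), V.compactIdeal_le ha.2⟩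

theorem toeplitzMap_mem_covElements (V : BimoduleIso hσ ρ ρ') {d : Toeplitz hσ ρ}
    (hd : d ∈ covElements hσ ρ) : toeplitzMap V d ∈ covElements hσ ρ' := by
  obtain ⟨a, k, h, ha, rfl⟩ := hd
  exact ⟨a, toeplitzMap V k, h.map V, covIdeal_subset V ha, by rw [map_sub, toeplitzMap_toepC]⟩

theorem IsClosedIdeal.comap (V : BimoduleIso hσ ρ ρ') {J : Submodule ℂ (Toeplitz hσ ρ')}
    (hJ : IsClosedIdeal hσ ρ' J) :
    IsClosedIdeal hσ ρ (J.comap (toeplitzLinearMap V)) where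
  isClosed := hJ.isClosed.preimage (continuous_toeplitzMap V)
  mul_mem_left x y hy := by
    change toeplitzMap V (x * y) ∈ J
    rw [map_mul]
    exact hJ.mul_mem_left _ _ hy
  mul_mem_right x y hx := by
    change toeplitzMap V (x * y) ∈ J
    rw [map_mul]
    exact hJ.mul_mem_right _ _ hx

/-- By minimality: the preimage of the second ideal is a closed two-sided ideal containing the
generators of the first. -/
theorem covKernel_le_comap (V : BimoduleIso hσ ρ ρ') :
    covKernel hσ ρ ≤ (covKernel hσ ρ').comap (toeplitzLinearMap V) := by
  refine sInf_le ⟨(isClosedIdeal_covKernel hσ ρ').comap V, fun d hd => ?_⟩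
  change toeplitzMap V d ∈ covKernel hσ ρ'
  rw [covKernel, Submodule.mem_sInf]
  exact fun J hJ => hJ.2 (toeplitzMap_mem_covElements V hd)

/-- The linear map of crossed products induced by an isomorphism of Hilbert bimodules. -/
def crossedProductMap (V : BimoduleIso hσ ρ ρ') : CrossedProduct hσ ρ →ₗ[ℂ] CrossedProduct hσ ρ' :=
  (covKernel hσ ρ).mapQ (covKernel hσ ρ') (toeplitzLinearMap V) (covKernel_le_comap V)

theorem crossedProductMap_mk (V : BimoduleIso hσ ρ ρ') (x : Toeplitz hσ ρ) :
    crossedProductMap V (toCrossedProduct hσ ρ x) = toCrossedProduct hσ ρ' (toeplitzMap V x) :=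
  rfl

theorem crossedProductMap_symm_crossedProductMap (V : BimoduleIso hσ ρ ρ')
    (x : CrossedProduct hσ ρ) : crossedProductMap V.symm (crossedProductMap V x) = x := by
  obtain ⟨x, rfl⟩ := toCrossedProduct_surjective hσ ρ x
  rw [crossedProductMap_mk, crossedProductMap_mk, toeplitzMap_symm_toeplitzMap]

/-- The isomorphism of crossed products induced by an isomorphism of Hilbert bimodules. -/
def crossedProductEquiv (V : BimoduleIso hσ ρ ρ') :
    CrossedProduct hσ ρ ≃⋆ₐ[ℂ] CrossedProduct hσ ρ' where
  toFun := crossedProductMap V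
  invFun := crossedProductMap V.symm
  left_inv := crossedProductMap_symm_crossedProductMap V
  right_inv := crossedProductMap_symm_crossedProductMap V.symm
  map_add' := map_add _
  map_smul' := map_smul _
  map_mul' x y := by
    obtain ⟨x, rfl⟩ := toCrossedProduct_surjective hσ ρ x
    obtain ⟨y, rfl⟩ := toCrossedProduct_surjective hσ ρ y
    rw [← toCrossedProduct_mul, crossedProductMap_mk, map_mul, toCrossedProduct_mul,
      crossedProductMap_mk, crossedProductMap_mk]
  map_star' x := by
    obtain ⟨x, rfl⟩ := toCrossedProduct_surjective hσ ρ x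
    rw [← toCrossedProduct_star, crossedProductMap_mk, map_star, toCrossedProduct_star,
      crossedProductMap_mk]

end Functoriality

/-! ### The square root of `|r|` and the conclusion -/

theorem star_sqrtAbs_mul_sqrtAbs {Y : Type*} [TopologicalSpace Y] (r : C(Y, ℂ)) (y : Y) :
    star (sqrtAbs r y) * sqrtAbs r y = ((‖r y‖ : ℝ) : ℂ) := by
  change (starRingEnd ℂ) ((√‖r y‖ : ℝ) : ℂ) * ((√‖r y‖ : ℝ) : ℂ) = _
  rw [Complex.conj_ofReal, ← Complex.ofReal_mul, Real.mul_self_sqrt (norm_nonneg _)]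

theorem sqrtAbs_ne_zero {Y : Type*} [TopologicalSpace Y] {r : C(Y, ℂ)} {y : Y} (h : r y ≠ 0) :
    sqrtAbs r y ≠ 0 :=
  Complex.ofReal_ne_zero.2 (Real.sqrt_ne_zero'.2 (norm_pos_iff.2 h))

end PartialCrossedProduct

end

theorem mainTheorem4 {X : Type*} [TopologicalSpace X] [CompactSpace X] [T2Space X]
    (U : TopologicalSpace.Opens X) (σ : U → X) (hσ : IsLocalHomeomorph σ)
    (ρ ρ' : C(U, ℝ≥0)) (r : C(U, ℂ)) (hr : ∀ y, r y ≠ 0)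
    (hρ : ∀ y, ((ρ y : ℝ) : ℂ) = r y * ((ρ' y : ℝ) : ℂ)) :
    ∃ ψ : CrossedProduct hσ ρ ≃⋆ₐ[ℂ] CrossedProduct hσ ρ',
      (∀ f : C(X, ℂ), ψ (ofC hσ ρ f) = ofC hσ ρ' f) ∧
      ∀ g : C_c(U, ℂ),
        ψ (ofM hσ ρ (hat hσ ρ g)) = ofM hσ ρ' (hat hσ ρ' (sqrtAbs r • g)) := by
  have hne : ∀ y, sqrtAbs r y ≠ 0 := fun y => sqrtAbs_ne_zero (hr y)
  have hs : ∀ y, ((ρ y : ℝ) : ℂ) =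
      star (sqrtAbs r y) * sqrtAbs r y * ((ρ' y : ℝ) : ℂ) := by
    intro y
    -- Taking norms replaces `r` by `|r|` without a case distinction; where `ρ'` vanishes, `r` may
    -- be any nonzero complex number.
    have h := congrArg norm (hρ y)
    rw [norm_mul, Complex.norm_of_nonneg (ρ y).coe_nonneg,
      Complex.norm_of_nonneg (ρ' y).coe_nonneg] at h
    rw [star_sqrtAbs_mul_sqrtAbs, h, Complex.ofReal_mul]
  -- The inverse multiplier is continuous because `r` has no zeros; it may be unbounded, as only the
  -- action on `C_c(U)` is needed.
  let s' : C(U, ℂ) := ⟨fun y => (sqrtAbs r y)⁻¹, (sqrtAbs r).continuous.inv₀ hne⟩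
  have hs' : ∀ y, ((ρ' y : ℝ) : ℂ) = star (s' y) * s' y * ((ρ y : ℝ) : ℂ) := by
    intro y
    have h1 := hne y
    have h2 : star (sqrtAbs r y) ≠ 0 := star_ne_zero.2 h1
    rw [hs y]
    change _ = star (sqrtAbs r y)⁻¹ * (sqrtAbs r y)⁻¹ * _
    rw [star_inv₀]
    field_simp
  let V : BimoduleIso hσ ρ ρ' := scaleIso hs hs' fun y => inv_mul_cancel₀ (hne y)
  -- Pulling back along `V` leaves the representation of `C(X)` untouched, so the first formula is
  -- definitional. The second reduces to the value of `V` on the class of `g`.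
  refine ⟨crossedProductEquiv V, fun f => rfl, fun g => ?_⟩
  exact congrArg (ofM hσ ρ') (scale_hat hs g)
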